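/- **Setting.** An instance of preemptive single-machine scheduling consists of finitely many jobs $j$ with release dates $r_j\ge 0$ and processing times $p_j>0$. A schedule specifies the amount $y_j(t)$ of processing that each job $j$ has received until time $t$: $y_j$ is nondecreasing, $y_j(t)=0$ for $t\le r_j$, $y_j\le p_j$, and $\sum_j (y_j(t)-y_j(s))\le t-s$ for all $s\le t$ (so the unit-speed machine may be shared among jobs). The completion time $C_j$ is the earliest $t$ with $y_j(t)=p_j$ ($C_j=\infty$ if there is none), and the cost of a schedule is its total flow time $\sum_j (C_j-r_j)$. Let $\mathrm{OPT}(I)$ denote the infimum of the total flow time over all schedules of the instance $I$. Let $\alpha\in[0,1]$. Job $j$ *emits its signal* at the earliest time $t\ge r_j$ with $y_j(t)\ge\alpha p_j$; at that moment $p_j$ is revealed. A deterministic $\alpha$-clairvoyant algorithm assigns to every instance a schedule such that, for every $t$, the schedule up to time $t$ is determined by the jobs released before $t$ (their names and release dates) and the signals emitted before $t$ (their times, and the names and processing times of the emitting jobs). A randomized $\alpha$-clairvoyant algorithm $A$ is a probability distribution over deterministic $\alpha$-clairvoyant algorithms. It is $c$-competitive if $\mathbb{E}[A(I)]\le c\cdot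 \mathrm{OPT}(I)$ for every instance $I$, where $A(I)$ is its total flow time on $I$; its competitive ratio is the infimum of all $c\in[0,\infty]$ for which it is $c$-competitive. **Theorem.** For every $\alpha\in(0,1)$, every randomized $\alpha$-clairvoyant algorithm for minimizing the total flow time on a single machine has competitive ratio at least $\frac32$. -/

import Mathlib

open MeasureTheory
open scoped ENNReal

namespace FlowTime

/-- A (finite) instance of single-machine scheduling with release dates. Jobs carry
natural-number names; the values of `release` and `proc` outside `jobs` are irrelevant. -/
structure Instance where
  jobs : Finset ℕ
  release : ℕ → ℝ
  proc : ℕ → ℝ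
  release_nonneg : ∀ j ∈ jobs, 0 ≤ release j
  proc_pos : ∀ j ∈ jobs, 0 < proc j

/-- A feasible preemptive schedule of `I` on one unit-speed machine. It is given by the amounts
`y j t` of processing that job `j` has received until time `t`. The machine may be shared between
several jobs at the same time, at total rate at most one; running one job at a time is
the special case in which at each time one rate is one and all others vanish. -/
structure IsSchedule (I : Instance) (y : ℕ → ℝ → ℝ) : Prop where
  mono : ∀ j, Monotone (y j)
  not_job : ∀ j, j ∉ I.jobs → ∀ t, y j t = 0
  before_release : ∀ j ∈ I.jobs, ∀ t, t ≤ I.release j → y j t = 0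
  le_proc : ∀ j ∈ I.jobs, ∀ t, y j t ≤ I.proc j
  speed : ∀ s t, s ≤ t → ∑ j ∈ I.jobs, (y j t - y j s) ≤ t - s

/-- Completion time of job `j`: the earliest time at which it has been fully processed
(`⊤` if there is none). -/
noncomputable def completionTime (I : Instance) (y : ℕ → ℝ → ℝ) (j : ℕ) : ℝ≥0∞ :=
  ⨅ (t : ℝ) (_ : I.proc j ≤ y j t), ENNReal.ofReal t

/-- Total flow time: the sum over all jobs of completion time minus release date. -/
noncomputable def totalFlow (I : Instance) (y : ℕ → ℝ → ℝ) : ℝ≥0∞ :=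
  ∑ j ∈ I.jobs, (completionTime I y j - ENNReal.ofReal (I.release j))

/-- The offline optimum. -/
noncomputable def opt (I : Instance) : ℝ≥0∞ :=
  ⨅ (y : ℕ → ℝ → ℝ) (_ : IsSchedule I y), totalFlow I y

/-- What is known about arrivals at time `u`: names and release dates of the jobs released
until then. -/
def arrivals (I : Instance) (u : ℝ) : Set (ℕ × ℝ) :=
  {x | ∃ j ∈ I.jobs, I.release j ≤ u ∧ x = (j, I.release j)}

/-- What the signals have revealed by time `u`: the jobs that have emitted their signal, which
happens once an `α`-fraction of the job is processed, together with their processing times. -/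
def signals (α : ℝ) (I : Instance) (y : ℕ → ℝ → ℝ) (u : ℝ) : Set (ℕ × ℝ) :=
  {x | ∃ j ∈ I.jobs, I.release j ≤ u ∧ α * I.proc j ≤ y j u ∧ x = (j, I.proc j)}

/-- A deterministic `α`-clairvoyant online algorithm: it produces a feasible schedule for each
instance, and what it does until time `t` is determined by the arrivals and signals that it
observes before time `t`. (For `α ≤ 1` a job emits no later than it completes, so completions
are known from the signals and the algorithm's own schedule.) -/
structure DetAlgorithm (α : ℝ) where
  sched : Instance → ℕ → ℝ → ℝ
  feasible : ∀ I, IsSchedule I (sched I)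
  online : ∀ (I I' : Instance) (t : ℝ),
    (∀ u < t, arrivals I u = arrivals I' u ∧
      signals α I (sched I) u = signals α I' (sched I') u) →
    ∀ j, ∀ u ≤ t, sched I j u = sched I' j u

/-- A randomized `α`-clairvoyant online algorithm: a random deterministic one. -/
structure RandAlgorithm (α : ℝ) where
  Ω : Type*
  [measurableSpace : MeasurableSpace Ω]
  μ : Measure Ω
  [isProbabilityMeasure : IsProbabilityMeasure μ]
  alg : Ω → DetAlgorithm α
  measurable_sched : ∀ (I : Instance) (j : ℕ) (t : ℝ), Measurable fun ω => (alg ω).sched I j t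

attribute [instance] RandAlgorithm.measurableSpace RandAlgorithm.isProbabilityMeasure

/-- Expected total flow time on a fixed instance. -/
noncomputable def RandAlgorithm.expectedFlow {α : ℝ} (A : RandAlgorithm α) (I : Instance) :
    ℝ≥0∞ :=
  ∫⁻ ω, totalFlow I ((A.alg ω).sched I) ∂A.μ

/-- `A` is `c`-competitive: its expected total flow time is at most `c` times the optimum, on
every instance. -/
def RandAlgorithm.IsCompetitive {α : ℝ} (A : RandAlgorithm α) (c : ℝ≥0∞) : Prop :=
  ∀ I : Instance, A.expectedFlow I ≤ c * opt I

/-- The competitive ratio: the infimum of all `c` such that `A` is `c`-competitive. -/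
noncomputable def RandAlgorithm.competitiveRatio {α : ℝ} (A : RandAlgorithm α) : ℝ≥0∞ :=
  sInf {c | A.IsCompetitive c}

end FlowTime

namespace FlowTime

/-! ### Schedules and completion times -/

/-! The bound is an averaging argument in the style of Yao. Pair `i` consists of a short and a long
job, and a fair coin decides which name is short. The short job exactly fills the time until the
next pair arrives, so the optimum finishes every short job at once, serves the stream without delay
and postpones the long jobs. If the stream has length `M`, this costs about `k * M`.

An algorithm cannot tell the two jobs of a pair apart during the first `α * (β ^ i - β ^ (i + 1))`
time units, since neither can emit in that time. As `β` is small compared with `α`, this phase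
exceeds twice the slack `β ^ (i + 1)` left for the short job, so one of the two outcomes of the coin
makes the short job late (`delayed_or_delayed`). A late short job must wait for the end of the
stream or take time from it. Taking as much as `β ^ k` in total is ruinous, because the stream jobs
are so tiny that a large number of them is then late (`le_totalFlow`).

Thus each pair costs at least `M` for the long job and, with probability at least `1 / 2`, another
`M` for the short one. The ratio is at least `3 * k / (2 * (k + 2))`, which tends to `3 / 2`. -/

theorem IsSchedule.sum_sub_le {I : Instance} {y : ℕ → ℝ → ℝ} (hy : IsSchedule I y)
    {J : Finset ℕ} (hJ : J ⊆ I.jobs) {s t : ℝ} (hst : s ≤ t) :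
    ∑ j ∈ J, (y j t - y j s) ≤ t - s :=
  (Finset.sum_le_sum_of_subset_of_nonneg hJ fun j _ _ =>
    sub_nonneg.2 (hy.mono j hst)).trans (hy.speed s t hst)

theorem IsSchedule.sub_le {I : Instance} {y : ℕ → ℝ → ℝ} (hy : IsSchedule I y)
    {j : ℕ} (hj : j ∈ I.jobs) {s t : ℝ} (hst : s ≤ t) : y j t - y j s ≤ t - s := by
  simpa using hy.sum_sub_le (J := {j}) (by simpa using hj) hst

theorem ofReal_le_completionTime {I : Instance} {y : ℕ → ℝ → ℝ} {j : ℕ} (hy : Monotone (y j))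
    {t : ℝ} (ht : y j t < I.proc j) : ENNReal.ofReal t ≤ completionTime I y j := by
  refine le_iInf₂ fun s hs => ENNReal.ofReal_le_ofReal ?_
  by_contra! h
  linarith [hy h.le]

theorem ofReal_le_flow {I : Instance} {y : ℕ → ℝ → ℝ} {j : ℕ} (hj : j ∈ I.jobs)
    (hy : Monotone (y j)) {t d : ℝ} (ht : y j t < I.proc j) (hd : d ≤ t - I.release j) :
    ENNReal.ofReal d ≤ completionTime I y j - ENNReal.ofReal (I.release j) := by
  refine (ENNReal.ofReal_le_ofReal hd).trans ?_
  rw [ENNReal.ofReal_sub _ (I.release_nonneg j hj)]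
  exact tsub_le_tsub_right (ofReal_le_completionTime hy ht) _

theorem flow_le_ofReal {I : Instance} {y : ℕ → ℝ → ℝ} {j : ℕ} (hj : j ∈ I.jobs)
    {t d : ℝ} (ht : I.proc j ≤ y j t) (hd : t - I.release j ≤ d) :
    completionTime I y j - ENNReal.ofReal (I.release j) ≤ ENNReal.ofReal d := by
  refine le_trans ?_ (ENNReal.ofReal_le_ofReal hd)
  rw [ENNReal.ofReal_sub _ (I.release_nonneg j hj)]
  exact tsub_le_tsub_right (iInf₂_le t ht) _

/-- By monotonicity the times at which `j` is complete form an up-set, so rational times suffice. A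
countable infimum is what makes the random total flow measurable. -/
theorem completionTime_eq_iInf_rat {I : Instance} {y : ℕ → ℝ → ℝ} {j : ℕ}
    (hy : Monotone (y j)) :
    completionTime I y j = ⨅ q : ℚ, if I.proc j ≤ y j q then ENNReal.ofReal q else ⊤ := by
  apply le_antisymm
  · refine le_iInf fun q => ?_
    split_ifs with h
    · exact iInf₂_le (q : ℝ) h
    · exact le_top
  · refine le_iInf₂ fun t ht => le_of_forall_gt fun a ha => ?_
    obtain ⟨b, hb, hba⟩ : ∃ b : ℝ, t < b ∧ ENNReal.ofReal b < a :=
      (((ENNReal.continuous_ofReal.tendsto t).eventually (gt_mem_nhds ha)).filter_mono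
        nhdsWithin_le_nhds |>.and self_mem_nhdsWithin).exists (f := nhdsWithin t (Set.Ioi t))
        |>.imp fun b hb => ⟨hb.2, hb.1⟩
    obtain ⟨q, hq, hqb⟩ := exists_rat_btwn hb
    refine (iInf_le _ q).trans_lt ?_
    rw [if_pos (ht.trans (hy hq.le))]
    exact (ENNReal.ofReal_le_ofReal hqb.le).trans_lt hba

theorem RandAlgorithm.measurable_totalFlow {α : ℝ} (A : RandAlgorithm α) (I : Instance) :
    Measurable fun ω => totalFlow I ((A.alg ω).sched I) := by
  refine Finset.measurable_sum _ fun j _ => Measurable.sub_const ?_ _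
  simp_rw [completionTime_eq_iInf_rat (((A.alg _).feasible I).mono j)]
  exact Measurable.iInf fun q => Measurable.ite
    (measurableSet_le measurable_const (A.measurable_sched I j q)) measurable_const
    measurable_const

/-! ### Indistinguishable instances -/

/-- Two instances that differ only in the processing times of jobs that have not emitted their
signal before time `τ` are treated alike until then. -/
theorem DetAlgorithm.sched_eq_of_no_signal {α : ℝ} (D : DetAlgorithm α)
    {I I' : Instance} (hjobs : I.jobs = I'.jobs) (hrel : I.release = I'.release) {τ : ℝ}
    (hproc : ∀ j ∈ I.jobs, I.proc j = I'.proc j ∨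
      ∀ u < τ, D.sched I j u < α * I.proc j ∧ D.sched I' j u < α * I'.proc j) :
    ∀ j, ∀ u ≤ τ, D.sched I j u = D.sched I' j u := by
  have hy := D.feasible I
  have hy' := D.feasible I'
  -- The axiom `online` presupposes equal signals, which themselves depend on the schedules. This
  -- circularity is broken by continuous induction on the supremum of the times of agreement.
  have key : ∀ t ≤ τ, (∀ j ∈ I.jobs, I.proc j = I'.proc j → ∀ u < t,
      (α * I.proc j ≤ D.sched I j u ↔ α * I.proc j ≤ D.sched I' j u)) →
      ∀ j, ∀ u ≤ t, D.sched I j u = D.sched I' j u := by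
    intro t ht h
    refine D.online I I' t fun u hu => ⟨by simp [arrivals, hjobs, hrel], ?_⟩
    ext x
    simp only [signals, Set.mem_ofPred_eq, ← hjobs, ← hrel]
    refine exists_congr fun j => and_congr_right fun hj => and_congr_right fun _ => ?_
    rcases hproc j hj with he | hn
    · rw [h j hj he u hu, he]
    · have := hn u (hu.trans_le ht)
      constructor
      · rintro ⟨h1, -⟩
        exact absurd h1 (not_le.2 this.1)
      · rintro ⟨h1, -⟩
        exact absurd h1 (not_le.2 this.2)
  set S : Set ℝ := {t | t ≤ τ ∧ ∀ j, ∀ u ≤ t, D.sched I j u = D.sched I' j u} with hS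
  have hbdd : BddAbove S := ⟨τ, fun t ht => ht.1⟩
  have hne : S.Nonempty := by
    refine ⟨min 0 τ, min_le_right _ _, fun j u hu => ?_⟩
    have hu0 : u ≤ 0 := hu.trans (min_le_left _ _)
    by_cases hj : j ∈ I.jobs
    · have hr := I.release_nonneg j hj
      rw [hy.before_release j hj u (hu0.trans hr),
        hy'.before_release j (hjobs ▸ hj) u (hrel ▸ hu0.trans hr)]
    · rw [hy.not_job j hj, hy'.not_job j (hjobs ▸ hj)]
  set s := sSup S with hs
  have hsτ : s ≤ τ := csSup_le hne fun t ht => ht.1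
  have hsS : ∀ j, ∀ u ≤ s, D.sched I j u = D.sched I' j u := by
    refine key s hsτ fun j _ _ u hu => ?_
    obtain ⟨t, ht, hut⟩ := exists_lt_of_lt_csSup hne hu
    rw [ht.2 j u hut.le]
  rcases hsτ.eq_or_lt with h | hlt
  · rwa [← h]
  exfalso
  -- Agreement extends beyond `s`: a signal emitted by time `s` stays emitted, and at unit speed a
  -- job below its threshold at `s` stays below it for a while in both schedules.
  have hev : ∀ j ∈ I.jobs, ∀ᶠ x in nhdsWithin s (Set.Ioi s), I.proc j = I'.proc j → ∀ u < x,
      (α * I.proc j ≤ D.sched I j u ↔ α * I.proc j ≤ D.sched I' j u) := by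
    intro j hj
    have hj' : j ∈ I'.jobs := hjobs ▸ hj
    rcases le_or_gt (α * I.proc j) (D.sched I j s) with hle | hgt
    · refine Filter.Eventually.of_forall fun x _ u _ => ?_
      rcases le_total u s with hus | hsu
      · rw [hsS j u hus]
      · have h1 := hy.mono j hsu
        have h2 := hy'.mono j hsu
        rw [← hsS j s le_rfl] at h2
        exact ⟨fun _ => hle.trans h2, fun _ => hle.trans h1⟩
    · have : Set.Iio (s + (α * I.proc j - D.sched I j s)) ∈ nhdsWithin s (Set.Ioi s) :=
        nhdsWithin_le_nhds (Iio_mem_nhds (by linarith))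
      filter_upwards [this] with x hx _ u hu
      rcases le_total u s with hus | hsu
      · rw [hsS j u hus]
      · have h1 := hy.sub_le hj hsu
        have h2 := hy'.sub_le hj' hsu
        rw [← hsS j s le_rfl] at h2
        simp only [Set.mem_Iio] at hx
        constructor <;> intro <;> linarith
  obtain ⟨x, hx, hxs, hxτ⟩ := (((Filter.eventually_all_finset _).2 hev).and
    (Ioc_mem_nhdsGT hlt)).exists
  exact hxs.not_ge (le_csSup hbdd ⟨hxτ, key x hxτ hx⟩)

/-! ### Nonpreemptive schedules -/

/-- Running each job `j` without interruption from time `b j` on is feasible if the resulting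
intervals do not overlap and no job starts before its release. -/
theorem isSchedule_of_intervals (I : Instance) (b : ℕ → ℝ)
    (hb : ∀ j ∈ I.jobs, I.release j ≤ b j)
    (hdisj : ∀ i ∈ I.jobs, ∀ j ∈ I.jobs, i ≠ j →
      b i + I.proc i ≤ b j ∨ b j + I.proc j ≤ b i) :
    IsSchedule I fun j t => if j ∈ I.jobs then max 0 (min (I.proc j) (t - b j)) else 0 where
  mono j := by
    intro s t hst
    dsimp only
    split_ifs
    · gcongr
    · exact le_rfl
  not_job j hj t := if_neg hj
  before_release j hj t ht := by
    rw [if_pos hj]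
    exact max_eq_left ((min_le_right _ _).trans (by linarith [hb j hj]))
  le_proc j hj t := by
    rw [if_pos hj]
    exact max_le (I.proc_pos j hj).le (min_le_left _ _)
  speed s t hst := by
    -- The work on `j` during `(s, t]` is the length of its part of that interval; disjointness of
    -- these parts yields the speed bound.
    have hvol : ∀ j ∈ I.jobs,
        ENNReal.ofReal (max 0 (min (I.proc j) (t - b j)) - max 0 (min (I.proc j) (s - b j))) =
          volume (Set.Ioc (max (b j) s) (min (b j + I.proc j) t)) := by
      intro j hj
      have hp := I.proc_pos j hj
      rw [Real.volume_Ioc]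
      rcases le_total (min (b j + I.proc j) t) (max (b j) s) with h | h
      · rw [ENNReal.ofReal_of_nonpos (sub_nonpos.2 h), ENNReal.ofReal_of_nonpos]
        grind
      · congr 1
        grind
    have hnn : ∀ j ∈ I.jobs,
        0 ≤ max 0 (min (I.proc j) (t - b j)) - max 0 (min (I.proc j) (s - b j)) := by
      intro j _
      rw [sub_nonneg]
      gcongr
    have hsum : ∑ j ∈ I.jobs, volume (Set.Ioc (max (b j) s) (min (b j + I.proc j) t)) ≤
        volume (Set.Ioc s t) := by
      rw [← measure_biUnion_finset _ fun j _ => measurableSet_Ioc]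
      · refine measure_mono (Set.iUnion₂_subset fun j _ => ?_)
        exact Set.Ioc_subset_Ioc (le_max_right _ _) (min_le_right _ _)
      · intro i hi j hj hij
        refine Set.disjoint_left.2 fun x hx hx' => ?_
        simp only [Set.mem_Ioc, max_lt_iff, le_min_iff] at hx hx'
        rcases hdisj i hi j hj hij with h | h <;> linarith
    rw [Real.volume_Ioc, ← Finset.sum_congr rfl hvol, ← ENNReal.ofReal_sum_of_nonneg hnn,
      ENNReal.ofReal_le_ofReal_iff (sub_nonneg.2 hst)] at hsum
    refine le_of_eq_of_le (Finset.sum_congr rfl fun j hj => ?_) hsum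
    simp [hj]

/-! ### The hard instances -/

/-- Parameters of the hard instances: `k` pairs of jobs on geometrically decreasing scales
`β ^ i`, followed by a stream of `N` jobs of size `ε`. -/
structure Params where
  β : ℝ
  ε : ℝ
  k : ℕ
  N : ℕ
  β_pos : 0 < β
  β_lt_one : β < 1
  ε_pos : 0 < ε

namespace Params

variable (P : Params)

/-- Release date of the stream job `2 * k + m`. -/
noncomputable def streamTime (m : ℕ) : ℝ := 1 - P.β ^ P.k + m * P.ε

/-- Release dates: the pair `2 * i`, `2 * i + 1` arrives at time `1 - β ^ i`. -/
noncomputable def release (j : ℕ) : ℝ :=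
  if j < 2 * P.k then 1 - P.β ^ (j / 2) else P.streamTime (j - 2 * P.k)

/-- The short job of the pair `i`. -/
def short (σ : Finset ℕ) (i : ℕ) : ℕ := if i ∈ σ then 2 * i + 1 else 2 * i

/-- The long job of the pair `i`. -/
def long (σ : Finset ℕ) (i : ℕ) : ℕ := if i ∈ σ then 2 * i else 2 * i + 1

/-- Processing times: the short job of the pair `i` fits exactly between the releases of the pairs
`i` and `i + 1`, and the long one has size one. -/
noncomputable def proc (σ : Finset ℕ) (j : ℕ) : ℝ :=
  if j < 2 * P.k then
    if j = short σ (j / 2) then P.β ^ (j / 2) - P.β ^ (j / 2 + 1) else 1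
  else P.ε

theorem β_pow_succ_lt (i : ℕ) : P.β ^ (i + 1) < P.β ^ i :=
  pow_lt_pow_right_of_lt_one₀ P.β_pos P.β_lt_one i.lt_succ_self

theorem β_pow_le_one (i : ℕ) : P.β ^ i ≤ 1 := pow_le_one₀ P.β_pos.le P.β_lt_one.le

theorem β_pow_le {i j : ℕ} (h : i ≤ j) : P.β ^ j ≤ P.β ^ i :=
  pow_le_pow_of_le_one P.β_pos.le P.β_lt_one.le h

theorem β_pow_pos (i : ℕ) : 0 < P.β ^ i := pow_pos P.β_pos i

theorem streamTime_zero_le (m : ℕ) : 1 - P.β ^ P.k ≤ P.streamTime m :=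
  le_add_of_nonneg_right (mul_nonneg m.cast_nonneg P.ε_pos.le)

theorem streamTime_mono {m n : ℕ} (h : m ≤ n) : P.streamTime m ≤ P.streamTime n := by
  have : (m : ℝ) ≤ n := by exact_mod_cast h
  have := mul_le_mul_of_nonneg_right this P.ε_pos.le
  unfold streamTime
  linarith

theorem streamTime_succ (m : ℕ) : P.streamTime (m + 1) = P.streamTime m + P.ε := by
  simp only [streamTime]
  push_cast
  ring

theorem short_div (σ : Finset ℕ) (i : ℕ) : short σ i / 2 = i := by
  unfold short; split_ifs <;> omega

theorem long_div (σ : Finset ℕ) (i : ℕ) : long σ i / 2 = i := by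
  unfold long; split_ifs <;> omega

theorem long_ne_short (σ : Finset ℕ) (i : ℕ) : long σ i ≠ short σ i := by
  unfold long short; split_ifs <;> omega

variable {P}

theorem short_lt (σ : Finset ℕ) {i : ℕ} (hi : i < P.k) : short σ i < 2 * P.k := by
  unfold short; split_ifs <;> omega

theorem long_lt (σ : Finset ℕ) {i : ℕ} (hi : i < P.k) : long σ i < 2 * P.k := by
  unfold long; split_ifs <;> omega

theorem release_short (σ : Finset ℕ) {i : ℕ} (hi : i < P.k) :
    P.release (short σ i) = 1 - P.β ^ i := by
  rw [release, if_pos (short_lt σ hi), short_div]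

theorem release_long (σ : Finset ℕ) {i : ℕ} (hi : i < P.k) :
    P.release (long σ i) = 1 - P.β ^ i := by
  rw [release, if_pos (long_lt σ hi), long_div]

theorem release_stream (m : ℕ) : P.release (2 * P.k + m) = P.streamTime m := by
  rw [release, if_neg (by omega), Nat.add_sub_cancel_left]

theorem proc_short (σ : Finset ℕ) {i : ℕ} (hi : i < P.k) :
    P.proc σ (short σ i) = P.β ^ i - P.β ^ (i + 1) := by
  rw [proc, if_pos (short_lt σ hi), short_div, if_pos rfl]

theorem proc_long (σ : Finset ℕ) {i : ℕ} (hi : i < P.k) : P.proc σ (long σ i) = 1 := by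
  rw [proc, if_pos (long_lt σ hi), long_div, if_neg (long_ne_short σ i)]

theorem proc_stream (σ : Finset ℕ) (m : ℕ) : P.proc σ (2 * P.k + m) = P.ε := by
  rw [proc, if_neg (by omega)]

theorem cases_job (σ : Finset ℕ) {j : ℕ} (hj : j < 2 * P.k + P.N) :
    (∃ i < P.k, j = short σ i) ∨ (∃ i < P.k, j = long σ i) ∨ ∃ m < P.N, j = 2 * P.k + m := by
  rcases lt_or_ge j (2 * P.k) with h | h
  · have : j = short σ (j / 2) ∨ j = long σ (j / 2) := by
      unfold short long; split_ifs <;> omega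
    rcases this with h' | h'
    · exact .inl ⟨j / 2, by omega, h'⟩
    · exact .inr (.inl ⟨j / 2, by omega, h'⟩)
  · exact .inr (.inr ⟨j - 2 * P.k, by omega, by omega⟩)

theorem sum_pairs {M : Type*} [AddCommMonoid M] (σ : Finset ℕ) (f : ℕ → M) (n : ℕ) :
    ∑ j ∈ Finset.range (2 * n), f j = ∑ i ∈ Finset.range n, (f (short σ i) + f (long σ i)) := by
  induction n with
  | zero => simp
  | succ n ih =>
    rw [Finset.sum_range_succ, ← ih, show 2 * (n + 1) = 2 * n + 1 + 1 by ring,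
      Finset.sum_range_succ, Finset.sum_range_succ, add_assoc]
    unfold short long
    split_ifs
    · rw [add_comm (f (2 * n))]
    · rfl

theorem sum_jobs {M : Type*} [AddCommMonoid M] (σ : Finset ℕ) (f : ℕ → M) (n N : ℕ) :
    ∑ j ∈ Finset.range (2 * n + N), f j =
      ∑ i ∈ Finset.range n, (f (short σ i) + f (long σ i)) +
        ∑ m ∈ Finset.range N, f (2 * n + m) := by
  rw [← sum_pairs]
  exact Finset.sum_range_add f _ _

variable (P)

/-- The hard instance in which `σ` is the set of pairs whose short job has the odd name. -/
noncomputable def inst (σ : Finset ℕ) : Instance where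
  jobs := Finset.range (2 * P.k + P.N)
  release := P.release
  proc := P.proc σ
  release_nonneg j _ := by
    unfold release
    split_ifs
    · linarith [P.β_pow_le_one (j / 2)]
    · linarith [P.β_pow_le_one P.k, P.streamTime_zero_le (j - 2 * P.k)]
  proc_pos j _ := by
    unfold proc
    split_ifs
    · linarith [P.β_pow_succ_lt (j / 2)]
    · exact one_pos
    · exact P.ε_pos

/-! ### The optimum of the hard instances -/

/-- Starting times in a good schedule: long jobs are postponed to the end. -/
noncomputable def start (σ : Finset ℕ) (j : ℕ) : ℝ :=
  if j < 2 * P.k ∧ j ≠ short σ (j / 2) then P.streamTime P.N + (j / 2 : ℕ) else P.release j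

variable {P}

theorem start_short (σ : Finset ℕ) {i : ℕ} (hi : i < P.k) :
    P.start σ (short σ i) = 1 - P.β ^ i := by
  rw [start, short_div, if_neg (by simp), release_short σ hi]

theorem start_long (σ : Finset ℕ) {i : ℕ} (hi : i < P.k) :
    P.start σ (long σ i) = P.streamTime P.N + i := by
  rw [start, long_div, if_pos ⟨long_lt σ hi, long_ne_short σ i⟩]

theorem start_stream (σ : Finset ℕ) (m : ℕ) : P.start σ (2 * P.k + m) = P.streamTime m := by
  rw [start, if_neg (by omega), release_stream]

theorem release_le_start (σ : Finset ℕ) {j : ℕ} (hj : j < 2 * P.k + P.N) :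
    P.release j ≤ P.start σ j := by
  rcases cases_job σ hj with ⟨i, hi, rfl⟩ | ⟨i, hi, rfl⟩ | ⟨m, hm, rfl⟩
  · rw [start_short σ hi, release_short σ hi]
  · rw [start_long σ hi, release_long σ hi]
    linarith [P.streamTime_zero_le P.N, P.β_pow_le hi.le, (Nat.cast_nonneg i : (0 : ℝ) ≤ i)]
  · rw [start_stream, release_stream]

theorem start_disjoint (σ : Finset ℕ) {i j : ℕ} (hi : i < 2 * P.k + P.N)
    (hj : j < 2 * P.k + P.N) (hij : i ≠ j) :
    P.start σ i + P.proc σ i ≤ P.start σ j ∨ P.start σ j + P.proc σ j ≤ P.start σ i := by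
  have hshort : ∀ a < P.k, 1 - P.β ^ (a + 1) ≤ 1 - P.β ^ P.k := fun a ha => by
    linarith [P.β_pow_le (show a + 1 ≤ P.k from ha)]
  have hlong : ∀ a b : ℕ, a < b → P.streamTime P.N + a + 1 ≤ P.streamTime P.N + b :=
    fun a b h => by
      have : (a : ℝ) + 1 ≤ b := by exact_mod_cast h
      linarith
  have hN := P.streamTime_zero_le P.N
  have hstream : ∀ a < P.N, P.streamTime a + P.ε ≤ P.streamTime P.N := fun a ha => by
    rw [← streamTime_succ]
    exact P.streamTime_mono ha
  rcases cases_job σ hi with ⟨a, ha, rfl⟩ | ⟨a, ha, rfl⟩ | ⟨a, ha, rfl⟩ <;>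
    rcases cases_job σ hj with ⟨b, hb, rfl⟩ | ⟨b, hb, rfl⟩ | ⟨b, hb, rfl⟩ <;>
    simp only [start_short σ, start_long σ, start_stream, proc_short σ, proc_long σ, proc_stream,
      ha, hb]
  · rcases lt_trichotomy a b with h | rfl | h
    · left
      linarith [P.β_pow_le (show a + 1 ≤ b from h)]
    · exact absurd rfl hij
    · right
      linarith [P.β_pow_le (show b + 1 ≤ a from h)]
  · left
    linarith [hshort a ha, (Nat.cast_nonneg b : (0 : ℝ) ≤ b)]
  · left
    linarith [hshort a ha, P.streamTime_zero_le b]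
  · right
    linarith [hshort b hb, (Nat.cast_nonneg a : (0 : ℝ) ≤ a)]
  · rcases lt_trichotomy a b with h | rfl | h
    · exact .inl (hlong a b h)
    · exact absurd rfl hij
    · exact .inr (hlong b a h)
  · right
    linarith [hstream b hb, (Nat.cast_nonneg a : (0 : ℝ) ≤ a)]
  · right
    linarith [hshort b hb, P.streamTime_zero_le a]
  · left
    linarith [hstream a ha, (Nat.cast_nonneg b : (0 : ℝ) ≤ b)]
  · rcases lt_trichotomy a b with h | rfl | h
    · left
      rw [← streamTime_succ]
      exact P.streamTime_mono h
    · exact absurd rfl hij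
    · right
      rw [← streamTime_succ]
      exact P.streamTime_mono h

theorem opt_inst_le (σ : Finset ℕ) :
    opt (P.inst σ) ≤
      ENNReal.ofReal ((P.k + 1) * (P.N * P.ε) + P.k * (P.k + 2)) := by
  set I := P.inst σ
  have hjob : ∀ {j}, j ∈ I.jobs ↔ j < 2 * P.k + P.N := Finset.mem_range
  refine (iInf₂_le _ (isSchedule_of_intervals I (P.start σ)
    (fun j hj => release_le_start σ (hjob.1 hj))
    (fun i hi j hj => start_disjoint σ (hjob.1 hi) (hjob.1 hj)))).trans ?_
  set y : ℕ → ℝ → ℝ := fun j t =>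
    if j ∈ I.jobs then max 0 (min (I.proc j) (t - P.start σ j)) else 0 with hy
  have hflow : ∀ j < 2 * P.k + P.N, ∀ d, P.start σ j + P.proc σ j - P.release j ≤ d →
      completionTime I y j - ENNReal.ofReal (I.release j) ≤ ENNReal.ofReal d := by
    intro j hj d hd
    refine flow_le_ofReal (hjob.2 hj) (t := P.start σ j + P.proc σ j) ?_ hd
    rw [hy]
    dsimp only
    rw [if_pos (hjob.2 hj), add_sub_cancel_left]
    exact le_max_of_le_right (le_min le_rfl le_rfl)
  have hNε : 0 ≤ P.N * P.ε := mul_nonneg P.N.cast_nonneg P.ε_pos.le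
  have hk : (0 : ℝ) ≤ P.k := P.k.cast_nonneg
  have hpair : ∀ i ∈ Finset.range P.k,
      (completionTime I y (short σ i) - ENNReal.ofReal (I.release (short σ i))) +
        (completionTime I y (long σ i) - ENNReal.ofReal (I.release (long σ i))) ≤
        ENNReal.ofReal (2 + P.N * P.ε + P.k) := by
    intro i hi
    rw [Finset.mem_range] at hi
    have hi' : (i : ℝ) + 1 ≤ P.k := by exact_mod_cast hi
    have h1 := hflow _ ((short_lt σ hi).trans_le (Nat.le_add_right _ _)) 1 (by
      rw [start_short σ hi, proc_short σ hi, release_short σ hi]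
      linarith [P.β_pow_le_one i, P.β_pow_pos (i + 1)])
    have h2 := hflow _ ((long_lt σ hi).trans_le (Nat.le_add_right _ _)) (1 + P.N * P.ε + P.k) (by
      rw [start_long σ hi, proc_long σ hi, release_long σ hi, streamTime]
      linarith [P.β_pow_le_one i, P.β_pow_pos P.k])
    refine (add_le_add h1 h2).trans ?_
    rw [← ENNReal.ofReal_add zero_le_one (by linarith)]
    exact ENNReal.ofReal_le_ofReal (by linarith)
  have hstr : ∀ m ∈ Finset.range P.N,
      completionTime I y (2 * P.k + m) - ENNReal.ofReal (I.release (2 * P.k + m)) ≤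
        ENNReal.ofReal P.ε := by
    intro m hm
    rw [Finset.mem_range] at hm
    refine hflow _ (by omega) _ ?_
    rw [start_stream, proc_stream, release_stream]
    linarith
  calc totalFlow I y = _ := sum_jobs σ _ P.k P.N
    _ ≤ ∑ _i ∈ Finset.range P.k, ENNReal.ofReal (2 + P.N * P.ε + P.k) +
        ∑ _m ∈ Finset.range P.N, ENNReal.ofReal P.ε :=
      add_le_add (Finset.sum_le_sum hpair) (Finset.sum_le_sum hstr)
    _ = _ := by
      rw [← ENNReal.ofReal_sum_of_nonneg (fun _ _ => by linarith),
        ← ENNReal.ofReal_sum_of_nonneg (fun _ _ => P.ε_pos.le),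
        ← ENNReal.ofReal_add (Finset.sum_nonneg fun _ _ => by linarith)
          (Finset.sum_nonneg fun _ _ => P.ε_pos.le)]
      simp only [Finset.sum_const, Finset.card_range, nsmul_eq_mul]
      congr 1
      ring

variable (P)

/-! ### Delayed pairs -/

/-- The short job of the pair `i` is unfinished at the end of the stream, unless a considerable
amount of time is taken from the stream to process pairs. -/
def Delayed (σ : Finset ℕ) (y : ℕ → ℝ → ℝ) (i : ℕ) : Prop :=
  P.β ^ P.k ≤ ∑ j ∈ Finset.range (2 * P.k), (y j (P.streamTime P.N) - y j (1 - P.β ^ P.k)) ∨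
    y (short σ i) (P.streamTime P.N) < P.β ^ i - P.β ^ (i + 1)

variable {P}

theorem range_pairs_subset (σ : Finset ℕ) : Finset.range (2 * P.k) ⊆ (P.inst σ).jobs :=
  Finset.range_subset_range.2 (Nat.le_add_right _ _)

/-- Less than `β ^ k` of the short job can be made up during the stream. Counting back at unit speed
from time `1 - β ^ k` shows that all but `β ^ (i + 1)` of the first `x` time units went to the short
job, which bounds the share of the long one. -/
theorem lt_and_lt_of_not_delayed {σ : Finset ℕ} {y : ℕ → ℝ → ℝ} (hy : IsSchedule (P.inst σ) y)
    {i : ℕ} (hi : i < P.k) (hd : ¬ P.Delayed σ y i) {x : ℝ} (hx0 : 0 ≤ x)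
    (hx : x ≤ P.β ^ i - P.β ^ (i + 1)) :
    x - P.β ^ (i + 1) < y (short σ i) (1 - P.β ^ i + x) ∧
      y (long σ i) (1 - P.β ^ i + x) < P.β ^ (i + 1) := by
  rw [Delayed, not_or, not_le, not_lt] at hd
  obtain ⟨hW, hs⟩ := hd
  have hsJ := Finset.mem_range.2 (short_lt σ hi)
  have hlJ := Finset.mem_range.2 (long_lt σ hi)
  have hsj := range_pairs_subset σ hsJ
  have hlj := range_pairs_subset σ hlJ
  have h1 : y (short σ i) (P.streamTime P.N) - y (short σ i) (1 - P.β ^ P.k) < P.β ^ P.k :=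
    (Finset.single_le_sum
      (f := fun j => y j (P.streamTime P.N) - y j (1 - P.β ^ P.k))
      (fun j _ => sub_nonneg.2 (hy.mono j (P.streamTime_zero_le P.N))) hsJ).trans_lt hW
  have hk := P.β_pow_le (show i + 1 ≤ P.k from hi)
  have h2 := hy.sub_le hsj (show 1 - P.β ^ i + x ≤ 1 - P.β ^ P.k by linarith)
  have h3 := hy.sum_sub_le (J := {short σ i, long σ i})
    (Finset.insert_subset hsj (Finset.singleton_subset_iff.2 hlj))
    (show 1 - P.β ^ i ≤ 1 - P.β ^ i + x by linarith)
  rw [Finset.sum_pair (long_ne_short σ i).symm,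
    hy.before_release _ hsj (1 - P.β ^ i) (release_short σ hi).ge,
    hy.before_release _ hlj (1 - P.β ^ i) (release_long σ hi).ge] at h3
  constructor <;> linarith

theorem short_eq_long {σ σ' : Finset ℕ} {i : ℕ} (h : i ∈ σ ↔ i ∉ σ') :
    short σ i = long σ' i := by
  unfold short long
  by_cases hi : i ∈ σ' <;> simp [h, hi]

/-- An algorithm cannot avoid delaying a pair both in an instance and in the instance with the two
jobs of that pair interchanged. -/
theorem delayed_or_delayed {α : ℝ} (hα0 : 0 < α) (hα1 : α < 1)
    (hβ : 2 * P.β < α * (1 - P.β)) (D : DetAlgorithm α) {σ σ' : Finset ℕ} {i : ℕ} (hi : i < P.k)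
    (hne : ∀ j, j ≠ i → (j ∈ σ ↔ j ∈ σ')) (heq : i ∈ σ ↔ i ∉ σ') :
    P.Delayed σ (D.sched (P.inst σ)) i ∨ P.Delayed σ' (D.sched (P.inst σ')) i := by
  by_contra! h
  obtain ⟨h, h'⟩ := h
  have hpos : 0 < P.β ^ i - P.β ^ (i + 1) := sub_pos.2 (P.β_pow_succ_lt i)
  set x := α * (P.β ^ i - P.β ^ (i + 1)) with hx
  have hx0 : 0 < x := mul_pos hα0 hpos
  have hx1 : x ≤ P.β ^ i - P.β ^ (i + 1) := mul_le_of_le_one_left hpos.le hα1.le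
  have hb := (lt_and_lt_of_not_delayed (D.feasible _) hi h hx0.le hx1).1
  have hb' := (lt_and_lt_of_not_delayed (D.feasible _) hi h' hx0.le hx1).2
  have hproc : ∀ (ρ : Finset ℕ) (j : ℕ), j < 2 * P.k → j / 2 = i → ∀ u < 1 - P.β ^ i + x,
      D.sched (P.inst ρ) j u < α * (P.inst ρ).proc j := by
    intro ρ j hj hji u hu
    have hjj : j ∈ (P.inst ρ).jobs := range_pairs_subset ρ (Finset.mem_range.2 hj)
    have hle : x ≤ α * (P.inst ρ).proc j := by
      refine mul_le_mul_of_nonneg_left ?_ hα0.le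
      change _ ≤ P.proc ρ j
      rw [proc, if_pos hj, hji]
      split_ifs
      · exact le_rfl
      · linarith [P.β_pow_le_one i, P.β_pow_pos (i + 1)]
    have h0 : D.sched (P.inst ρ) j (1 - P.β ^ i) = 0 := by
      refine (D.feasible _).before_release j hjj _ ?_
      change _ ≤ P.release j
      rw [release, if_pos hj, hji]
    rcases le_total u (1 - P.β ^ i) with hui | hui
    · linarith [(D.feasible (P.inst ρ)).mono j hui]
    · linarith [(D.feasible (P.inst ρ)).sub_le hjj hui]
  have hagree := D.sched_eq_of_no_signal (I := P.inst σ) (I' := P.inst σ') rfl rfl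
    (τ := 1 - P.β ^ i + x) (fun j _ => by
      by_cases hj : j < 2 * P.k ∧ j / 2 = i
      · exact .inr fun u hu => ⟨hproc σ j hj.1 hj.2 u hu, hproc σ' j hj.1 hj.2 u hu⟩
      · left
        change P.proc σ j = P.proc σ' j
        unfold proc
        by_cases h1 : j < 2 * P.k
        · have : short σ (j / 2) = short σ' (j / 2) := by
            unfold short
            exact if_congr (hne _ fun h2 => hj ⟨h1, h2⟩) rfl rfl
          rw [this]
        · simp only [h1, if_false])
  -- The same job is short in one instance and long in the other, so its common progress lies above
  -- `x - β ^ (i + 1)` and below `β ^ (i + 1)`. This contradicts `2 * β ^ (i + 1) < x`.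
  rw [hagree _ _ le_rfl, short_eq_long heq] at hb
  have : 2 * P.β * P.β ^ i < α * (1 - P.β) * P.β ^ i := mul_lt_mul_of_pos_right hβ (P.β_pow_pos i)
  rw [pow_succ] at hx hb hb'
  linarith

/-! ### The cost of delayed pairs -/

/-- An unfinished job has flow at least `β ^ k / 2`. Weighting by the unfinished fraction makes the
bound linear in the remaining work, so that it can be summed without counting jobs. -/
theorem flow_stream_ge {σ : Finset ℕ} {y : ℕ → ℝ → ℝ} (hy : IsSchedule (P.inst σ) y)
    {m : ℕ} (hm : m < P.N) :
    ENNReal.ofReal (P.β ^ P.k / 2 * ((P.ε - y (2 * P.k + m)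
        (P.streamTime P.N + P.β ^ P.k / 2)) / P.ε)) ≤
      completionTime (P.inst σ) y (2 * P.k + m) -
        ENNReal.ofReal ((P.inst σ).release (2 * P.k + m)) := by
  have hmj : 2 * P.k + m ∈ (P.inst σ).jobs := Finset.mem_range.2 (by omega)
  have hδ : 0 ≤ P.β ^ P.k / 2 := (half_pos (P.β_pow_pos P.k)).le
  have hp : (P.inst σ).proc (2 * P.k + m) = P.ε := proc_stream σ m
  set v := P.streamTime P.N + P.β ^ P.k / 2 with hv
  have hle : y (2 * P.k + m) v ≤ P.ε := hp ▸ hy.le_proc _ hmj v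
  rcases hle.eq_or_lt with h | h
  · simp [h]
  · have h0 : 0 ≤ y (2 * P.k + m) v := by
      rw [← hy.before_release _ hmj _ le_rfl]
      refine hy.mono _ ((release_stream m).le.trans ((P.streamTime_mono hm.le).trans ?_))
      exact le_add_of_nonneg_right hδ
    refine (ENNReal.ofReal_le_ofReal (mul_le_of_le_one_right hδ
      ((div_le_one P.ε_pos).2 (by linarith)))).trans
      (ofReal_le_flow hmj (hy.mono _) (t := v) (hp ▸ h) ?_)
    have : (P.inst σ).release (2 * P.k + m) = P.streamTime m := release_stream m
    rw [this, hv]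
    linarith [P.streamTime_mono hm.le]

open scoped Classical in
theorem le_totalFlow {σ : Finset ℕ} {y : ℕ → ℝ → ℝ} (hy : IsSchedule (P.inst σ) y)
    (hε : 8 * P.k * (P.N * P.ε) * P.ε ≤ (P.β ^ P.k) ^ 2) :
    ENNReal.ofReal (P.N * P.ε) *
        ∑ i ∈ Finset.range P.k, (1 + if P.Delayed σ y i then 1 else 0) ≤
      totalFlow (P.inst σ) y := by
  set I := P.inst σ
  set δ := P.β ^ P.k with hδ
  have hδ0 : 0 < δ := P.β_pow_pos P.k
  have hM : 0 ≤ P.N * P.ε := mul_nonneg P.N.cast_nonneg P.ε_pos.le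
  have htot : totalFlow I y = _ := sum_jobs σ _ P.k P.N
  rw [htot]
  by_cases hW : δ ≤ ∑ j ∈ Finset.range (2 * P.k), (y j (P.streamTime P.N) - y j (1 - δ))
  -- Every pair counts as delayed here, so the target is `2 * k * (N * ε)`. The stream alone pays `δ
  -- ^ 2 / (4 * ε)`, which suffices by `hε`.
  · refine le_trans ?_ le_add_self
    calc
      _ ≤ ENNReal.ofReal (P.N * P.ε) * ∑ i ∈ Finset.range P.k, 2 := by
        gcongr
        split_ifs <;> norm_num
      _ = ENNReal.ofReal (P.N * P.ε * (P.k * 2)) := by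
        rw [ENNReal.ofReal_mul hM]
        simp [ENNReal.ofReal_mul]
      _ ≤ ENNReal.ofReal (∑ m ∈ Finset.range P.N, δ / 2 * ((P.ε - y (2 * P.k + m)
            (P.streamTime P.N + δ / 2)) / P.ε)) := by
        refine ENNReal.ofReal_le_ofReal ?_
        have h1 := hy.speed (1 - δ) (P.streamTime P.N + δ / 2)
          (by linarith [P.streamTime_zero_le P.N])
        have h2 : ∑ j ∈ I.jobs, (y j (P.streamTime P.N + δ / 2) - y j (1 - δ)) =
            ∑ j ∈ Finset.range (2 * P.k), (y j (P.streamTime P.N + δ / 2) - y j (1 - δ)) +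
            ∑ m ∈ Finset.range P.N, (y (2 * P.k + m) (P.streamTime P.N + δ / 2) -
              y (2 * P.k + m) (1 - δ)) := Finset.sum_range_add _ _ _
        have h3 : ∑ j ∈ Finset.range (2 * P.k), (y j (P.streamTime P.N) - y j (1 - δ)) ≤
            ∑ j ∈ Finset.range (2 * P.k), (y j (P.streamTime P.N + δ / 2) - y j (1 - δ)) :=
          Finset.sum_le_sum fun j _ =>
            sub_le_sub_right (hy.mono j (le_add_of_nonneg_right (by linarith))) _
        have h4 : ∑ m ∈ Finset.range P.N, (y (2 * P.k + m) (P.streamTime P.N + δ / 2) -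
              y (2 * P.k + m) (1 - δ)) =
            ∑ m ∈ Finset.range P.N, y (2 * P.k + m) (P.streamTime P.N + δ / 2) := by
          refine Finset.sum_congr rfl fun m hm => ?_
          rw [Finset.mem_range] at hm
          rw [hy.before_release (2 * P.k + m) (Finset.mem_range.2 (by omega)) (1 - δ), sub_zero]
          exact (P.streamTime_zero_le m).trans (release_stream m).ge
        rw [← Finset.mul_sum, ← Finset.sum_div, Finset.sum_sub_distrib, Finset.sum_const,
          Finset.card_range, nsmul_eq_mul, ← mul_div_assoc, le_div_iff₀ P.ε_pos]
        have h5 : P.streamTime P.N = 1 - δ + P.N * P.ε := rfl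
        -- In a window of length `N * ε + δ / 2` at least `δ` goes to pairs, so at least `δ / 2` of
        -- the stream work remains.
        have h6 : δ / 2 ≤ P.N * P.ε -
            ∑ m ∈ Finset.range P.N, y (2 * P.k + m) (P.streamTime P.N + δ / 2) := by
          linarith
        have h7 := mul_le_mul_of_nonneg_left h6 (half_pos hδ0).le
        linarith
      _ ≤ ∑ m ∈ Finset.range P.N, ENNReal.ofReal (δ / 2 * ((P.ε - y (2 * P.k + m)
            (P.streamTime P.N + δ / 2)) / P.ε)) :=
        Finset.le_sum_of_subadditive _ ENNReal.ofReal_zero.le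
          (fun _ _ => ENNReal.ofReal_add_le) _ _
      _ ≤ _ := Finset.sum_le_sum fun m hm => flow_stream_ge hy (Finset.mem_range.1 hm)
  -- With little time taken from the stream, each long job is still unfinished at its end, having
  -- received less than `(β ^ i - δ) + δ ≤ 1`. So is each delayed short job.
  · refine le_trans ?_ le_self_add
    rw [Finset.mul_sum]
    refine Finset.sum_le_sum fun i hi => ?_
    rw [Finset.mem_range] at hi
    have hsJ := Finset.mem_range.2 (short_lt σ hi)
    have hlJ := Finset.mem_range.2 (long_lt σ hi)
    have hsj := range_pairs_subset σ hsJ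
    have hlj := range_pairs_subset σ hlJ
    have hd : P.N * P.ε ≤ P.streamTime P.N - (1 - P.β ^ i) := by
      have h5 : P.streamTime P.N = 1 - δ + P.N * P.ε := rfl
      linarith [P.β_pow_le hi.le]
    rw [mul_add, mul_one, add_comm]
    refine add_le_add ?_ ?_
    · split_ifs with hD
      · rw [mul_one]
        exact ofReal_le_flow hsj (hy.mono _) (t := P.streamTime P.N)
          ((hD.resolve_left hW).trans_eq (proc_short σ hi).symm)
          (hd.trans_eq (by rw [← release_short σ hi]; rfl))
      · simp
    · refine ofReal_le_flow hlj (hy.mono _) (t := P.streamTime P.N) ?_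
        (hd.trans_eq (by rw [← release_long σ hi]; rfl))
      refine lt_of_lt_of_eq ?_ (proc_long σ hi).symm
      have h1 := (Finset.single_le_sum
        (f := fun j => y j (P.streamTime P.N) - y j (1 - δ))
        (fun j _ => sub_nonneg.2 (hy.mono j (P.streamTime_zero_le P.N))) hlJ).trans_lt
        (not_le.1 hW)
      have h2 := hy.sub_le hlj (show 1 - P.β ^ i ≤ 1 - δ by linarith [P.β_pow_le hi.le])
      rw [hy.before_release _ hlj (1 - P.β ^ i) (release_long σ hi).ge] at h2
      linarith [P.β_pow_pos i, P.β_pow_le_one i]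

/-! ### Averaging over the hard instances -/

open scoped Classical in
-- Flipping the coin of pair `i` is the involution `σ ↦ symmDiff σ {i}`, and at least one instance
-- of each orbit delays the pair.
theorem two_pow_le_sum_delayed {α : ℝ} (hα0 : 0 < α) (hα1 : α < 1)
    (hβ : 2 * P.β < α * (1 - P.β)) (D : DetAlgorithm α) {i : ℕ} (hi : i < P.k) :
    (2 : ℝ≥0∞) ^ P.k ≤ 2 * ∑ σ ∈ (Finset.range P.k).powerset,
      if P.Delayed σ (D.sched (P.inst σ)) i then 1 else 0 := by
  set f : Finset ℕ → ℝ≥0∞ := fun σ => if P.Delayed σ (D.sched (P.inst σ)) i then 1 else 0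
  have hmem : ∀ σ ∈ (Finset.range P.k).powerset,
      symmDiff σ {i} ∈ (Finset.range P.k).powerset := by
    intro σ hσ
    rw [Finset.mem_powerset] at hσ ⊢
    intro j hj
    rcases Finset.mem_symmDiff.1 hj with h | h
    · exact hσ h.1
    · rw [Finset.mem_singleton.1 h.1]
      exact Finset.mem_range.2 hi
  have hflip : ∑ σ ∈ (Finset.range P.k).powerset, f σ =
      ∑ σ ∈ (Finset.range P.k).powerset, f (symmDiff σ {i}) :=
    Finset.sum_bij' (fun σ _ => symmDiff σ {i}) (fun σ _ => symmDiff σ {i}) hmem hmem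
      (fun σ _ => symmDiff_symmDiff_cancel_right _ _)
      (fun σ _ => symmDiff_symmDiff_cancel_right _ _)
      (fun σ _ => by rw [symmDiff_symmDiff_cancel_right])
  calc (2 : ℝ≥0∞) ^ P.k = ∑ σ ∈ (Finset.range P.k).powerset, 1 := by simp
    _ ≤ ∑ σ ∈ (Finset.range P.k).powerset, (f σ + f (symmDiff σ {i})) := by
      refine Finset.sum_le_sum fun σ _ => ?_
      rcases delayed_or_delayed hα0 hα1 hβ D hi (σ := σ) (σ' := symmDiff σ {i})
        (fun j hj => by simp [Finset.mem_symmDiff, hj])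
        (by simp [Finset.mem_symmDiff]) with h | h
      · simp [f, h]
      · simp [f, h]
    _ = _ := by rw [Finset.sum_add_distrib, ← hflip, two_mul]

theorem le_sum_totalFlow {α : ℝ} (hα0 : 0 < α) (hα1 : α < 1)
    (hβ : 2 * P.β < α * (1 - P.β)) (hε : 8 * P.k * (P.N * P.ε) * P.ε ≤ (P.β ^ P.k) ^ 2)
    (D : DetAlgorithm α) :
    ENNReal.ofReal (P.N * P.ε) * (3 * P.k * 2 ^ P.k) ≤
      2 * ∑ σ ∈ (Finset.range P.k).powerset, totalFlow (P.inst σ) (D.sched (P.inst σ)) := by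
  classical
  calc
    _ = ENNReal.ofReal (P.N * P.ε) *
        ∑ _i ∈ Finset.range P.k, (2 * 2 ^ P.k + 2 ^ P.k : ℝ≥0∞) := by
      congr 1
      simp only [Finset.sum_const, Finset.card_range, nsmul_eq_mul]
      ring
    _ ≤ ENNReal.ofReal (P.N * P.ε) * ∑ i ∈ Finset.range P.k,
        (2 * ∑ σ ∈ (Finset.range P.k).powerset,
          (1 + if P.Delayed σ (D.sched (P.inst σ)) i then 1 else 0)) := by
      gcongr with i hi
      rw [Finset.sum_add_distrib, mul_add]
      gcongr
      · simp
      · exact two_pow_le_sum_delayed hα0 hα1 hβ D (Finset.mem_range.1 hi)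
    _ = 2 * ∑ σ ∈ (Finset.range P.k).powerset, (ENNReal.ofReal (P.N * P.ε) *
        ∑ i ∈ Finset.range P.k,
          (1 + if P.Delayed σ (D.sched (P.inst σ)) i then 1 else 0)) := by
      rw [← Finset.mul_sum, ← Finset.mul_sum, Finset.sum_comm]
      ring
    _ ≤ _ := by
      gcongr with σ
      exact le_totalFlow (D.feasible _) hε

theorem le_sum_expectedFlow {α : ℝ} (hα0 : 0 < α) (hα1 : α < 1)
    (hβ : 2 * P.β < α * (1 - P.β)) (hε : 8 * P.k * (P.N * P.ε) * P.ε ≤ (P.β ^ P.k) ^ 2)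
    (A : RandAlgorithm α) :
    ENNReal.ofReal (P.N * P.ε) * (3 * P.k * 2 ^ P.k) ≤
      2 * ∑ σ ∈ (Finset.range P.k).powerset, A.expectedFlow (P.inst σ) := by
  unfold RandAlgorithm.expectedFlow
  have hm : ∀ σ ∈ (Finset.range P.k).powerset,
      Measurable fun ω => totalFlow (P.inst σ) ((A.alg ω).sched (P.inst σ)) :=
    fun σ _ => A.measurable_totalFlow _
  rw [← lintegral_finsetSum _ hm, ← lintegral_const_mul _ (Finset.measurable_sum _ hm)]
  calc
    _ = ∫⁻ _, ENNReal.ofReal (P.N * P.ε) * (3 * P.k * 2 ^ P.k) ∂A.μ := by simp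
    _ ≤ _ := lintegral_mono fun ω => le_sum_totalFlow hα0 hα1 hβ hε (A.alg ω)

end Params

theorem RandAlgorithm.IsCompetitive.three_mul_le {α : ℝ} (hα0 : 0 < α) (hα1 : α < 1)
    {A : RandAlgorithm α} {c : ℝ≥0∞} (hc : A.IsCompetitive c) {k : ℕ} (hk : 0 < k) :
    (3 * k : ℝ≥0∞) ≤ 2 * c * (k + 2) := by
  have hβ0 : 0 < α / 4 := by linarith
  -- With this stream length, the term `k * (k + 2)` in the bound on the optimum is just one more
  -- `M`, for a total of `M * (k + 2)`.
  set M : ℝ := k * (k + 2) with hM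
  have hk' : (0 : ℝ) < k := by exact_mod_cast hk
  have hM0 : 0 < M := by positivity
  -- With `ε = M / N`, this is the smallness condition on `ε` solved for `N`.
  obtain ⟨N, hN⟩ := exists_nat_ge (8 * k * M * M / ((α / 4) ^ k) ^ 2)
  have hN0 : (0 : ℝ) < N := lt_of_lt_of_le (by positivity) hN
  let P : Params :=
    { β := α / 4, ε := M / N, k := k, N := N, β_pos := hβ0, β_lt_one := by linarith
      ε_pos := by positivity }
  have hNε : (P.N : ℝ) * P.ε = M := mul_div_cancel₀ _ hN0.ne'
  have hlow := P.le_sum_expectedFlow hα0 hα1 (by change 2 * (α / 4) < α * (1 - α / 4); nlinarith)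
    (by
      rw [hNε]
      change 8 * (k : ℝ) * M * (M / N) ≤ ((α / 4) ^ k) ^ 2
      rw [div_le_iff₀ (by positivity)] at hN
      rw [← mul_div_assoc, div_le_iff₀ hN0]
      linarith) A
  have hup : ∑ σ ∈ (Finset.range P.k).powerset, A.expectedFlow (P.inst σ) ≤
      2 ^ k * (c * (ENNReal.ofReal M * (k + 2))) := by
    calc
      _ ≤ ∑ σ ∈ (Finset.range P.k).powerset, c * (ENNReal.ofReal M * (k + 2)) := by
        refine Finset.sum_le_sum fun σ _ => (hc _).trans ?_
        gcongr
        refine (Params.opt_inst_le σ).trans_eq ?_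
        rw [hNε]
        change ENNReal.ofReal ((k + 1) * M + k * (k + 2)) = _
        rw [← hM, show ((k : ℝ) + 1) * M + M = M * (k + 2) by ring, ENNReal.ofReal_mul hM0.le,
          ENNReal.ofReal_add hk'.le zero_le_two, ENNReal.ofReal_natCast, ENNReal.ofReal_ofNat]
      _ = _ := by simp [P]
  rw [hNε] at hlow
  change ENNReal.ofReal M * (3 * k * 2 ^ k) ≤ _ at hlow
  have hfin : ENNReal.ofReal M * 2 ^ k ≠ ⊤ :=
    ENNReal.mul_ne_top ENNReal.ofReal_ne_top (ENNReal.pow_ne_top ENNReal.ofNat_ne_top)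
  have hne : ENNReal.ofReal M * 2 ^ k ≠ 0 :=
    mul_ne_zero (ENNReal.ofReal_pos.2 hM0).ne' (pow_ne_zero _ two_ne_zero)
  rw [← ENNReal.mul_le_mul_iff_right hne hfin]
  calc _ = ENNReal.ofReal M * (3 * k * 2 ^ k) := by ring
    _ ≤ 2 * (2 ^ k * (c * (ENNReal.ofReal M * (k + 2)))) :=
      hlow.trans (mul_le_mul_right hup 2)
    _ = _ := by ring

end FlowTime

theorem mainTheorem8 (α : ℝ) (hα0 : 0 < α) (hα1 : α < 1) (A : FlowTime.RandAlgorithm α) :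
    3 / 2 ≤ A.competitiveRatio := by
  refine le_sInf fun c hc => ?_
  rcases eq_or_ne c ⊤ with rfl | hctop
  · exact le_top
  lift c to NNReal using hctop
  have key : ∀ k : ℕ, 0 < k → (3 * k : ℝ) ≤ 2 * c * (k + 2) := fun k hk => by
    have h := FlowTime.RandAlgorithm.IsCompetitive.three_mul_le hα0 hα1 hc hk
    exact_mod_cast h
  rw [ENNReal.div_le_iff two_ne_zero ENNReal.ofNat_ne_top]
  have hreal : (3 : ℝ) ≤ c * 2 := by
    by_contra! hlt
    -- This is `2 * c * (n + 2) < 3 * n` solved for `n`, which contradicts `key`.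
    obtain ⟨n, hn⟩ := exists_nat_gt (4 * c / (3 - c * 2) : ℝ)
    rw [div_lt_iff₀ (by linarith)] at hn
    have hn0 : (0 : ℝ) < n := by
      by_contra! h0
      nlinarith [c.coe_nonneg]
    linarith [key n (by exact_mod_cast hn0)]
  exact_mod_cast hreal
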